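/- For $z$ in the upper half-plane $\mathbb{H}=\{z\in\mathbb{C}:\operatorname{Im} z>0\}$ let $p_z(x)=\dfrac{\operatorname{Im} z}{\pi\,|x-z|^2}$, $x\in\mathbb{R}$, be the density of the Cauchy distribution with location $\operatorname{Re} z$ and scale $\operatorname{Im} z$. For $z,w\in\mathbb{H}$ let $D_{\mathrm{KL}}(p_z:p_w)=\int_{\mathbb{R}}p_z(x)\log\frac{p_z(x)}{p_w(x)}\,dx$ be the Kullback--Leibler divergence, and let $\chi(z,w)=\dfrac{|z-w|^2}{2\operatorname{Im}(z)\operatorname{Im}(w)}$. Then $D_{\mathrm{KL}}(p_z:p_w)$ is finite and equal to $\log\bigl(1+\tfrac12\chi(z,w)\bigr)$ for all $z,w\in\mathbb{H}$, and the following hold. 1. The square root of the Kullback--Leibler divergence between Cauchy densities is isometrically embeddable into a Hilbert space: there are a real Hilbert space $H$ and a map $\varphi:\mathbb{H}\to H$ such that $\|\varphi(z)-\varphi(w)\|_H=\sqrt{D_{\mathrm{KL}}(p_z:p_w)}$ for all $z,w\in\mathbb{H}$. 2. Equivalently, the kernel $(z,w)\mapsto\log\bigl(1+\tfrac12\chi(z,w)\bigr)$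 is conditionally negative definite on $\mathbb{H}$: it is symmetric, and for all $n$, all $z_1,\dots,z_n\in\mathbb{H}$ and all $c_1,\dots,c_n\in\mathbb{R}$ with $\sum_{i=1}^n c_i=0$, $$\sum_{i,j=1}^n c_ic_j\log\Bigl(1+\tfrac12\chi(z_i,z_j)\Bigr)\le 0 .$$ -/

import Mathlib

open scoped ENNReal

/-- The Cauchy distribution with location `Re z` and scale `Im z > 0`, for `z` in the upper
half-plane. Its density is identified in `cauchyDist_eq_withDensity`. -/
noncomputable def cauchyDist (z : UpperHalfPlane) : MeasureTheory.Measure ℝ :=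
  ProbabilityTheory.cauchyMeasure z.re z.im.toNNReal

/-- The distribution `cauchyDist z` has the Lebesgue density `p_z(x) = Im z / (π |x - z|²)`. -/
theorem cauchyDist_eq_withDensity (z : UpperHalfPlane) :
    cauchyDist z = MeasureTheory.volume.withDensity
      (fun x : ℝ => ENNReal.ofReal (z.im / (Real.pi * ‖(x : ℂ) - (z : ℂ)‖ ^ 2))) := by
  have hz : z.im.toNNReal ≠ 0 := (Real.toNNReal_pos.mpr z.im_pos).ne'
  unfold cauchyDist
  rw [ProbabilityTheory.cauchyMeasure_of_scale_ne_zero _ hz]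
  congr 1
  funext x
  rw [ProbabilityTheory.cauchyPDF_def, ProbabilityTheory.cauchyPDFReal_def, Complex.sq_norm,
    Complex.normSq_apply, Real.coe_toNNReal _ z.im_pos.le]
  congr 1
  simp only [Complex.sub_re, Complex.sub_im, Complex.ofReal_re, Complex.ofReal_im,
    UpperHalfPlane.coe_re, UpperHalfPlane.coe_im]
  rw [div_eq_mul_inv, mul_inv]
  ring_nf

/-- The Kullback-Leibler divergence `D_KL(p_z : p_w) = ∫ p_z log (p_z / p_w)` between two Cauchy
distributions, a priori with values in `[0, ∞]`. -/
noncomputable def cauchyKL (z w : UpperHalfPlane) : ℝ≥0∞ :=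
  InformationTheory.klDiv (cauchyDist z) (cauchyDist w)

/-- The function `χ(z, w) = |z - w|² / (2 Im z Im w)` on the upper half-plane. -/
noncomputable def cauchyChi (z w : UpperHalfPlane) : ℝ :=
  ‖(z : ℂ) - (w : ℂ)‖ ^ 2 / (2 * z.im * w.im)

/-- A real-valued function `d` on `X × X` is isometrically embeddable into a Hilbert space if it is
the pullback of the norm distance of a real Hilbert space under some map. -/
def IsHilbertEmbeddable {X : Type} (d : X → X → ℝ) : Prop :=
  ∃ (H : Type) (_ : NormedAddCommGroup H) (_ : InnerProductSpace ℝ H) (_ : CompleteSpace H)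
    (φ : X → H), ∀ x y : X, ‖φ x - φ y‖ = d x y

/-- A real-valued kernel is conditionally negative definite if it is symmetric and its quadratic
forms are nonpositive on all coefficient vectors of sum zero. -/
def IsCondNegDef {X : Type} (K : X → X → ℝ) : Prop :=
  (∀ x y : X, K x y = K y x) ∧
    ∀ (n : ℕ) (x : Fin n → X) (c : Fin n → ℝ), ∑ i, c i = 0 →
      ∑ i, ∑ j, c i * c j * K (x i) (x j) ≤ 0

open MeasureTheory ComplexConjugate

/-! Divergence: `u = -(x - z) / (x - z̄)` carries the Cauchy law of `z` to the uniform law on the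
unit circle. In this coordinate the log density ratio is `log (1 + χ/2) + 2 log |u - c|` with `|c| <
1`, and the circle average of `log |u - c|` vanishes (`log_cauchyDensity_div`,
`integral_comp_cauchyAngle`). Embedding: a Cayley transform to the disk gives `1 + χ/2 = |1 - u v̄|²
/ ((1 - |u|²)(1 - |v|²))`. Since `-log |1 - u v̄| = Re ∑ (u v̄)ⁿ / n` is the real Gram kernel of
`(uⁿ / √n)` in `ℓ²`, `log (1 + χ/2)` is a squared distance there (`norm_logFeature_sub_sq`).
Negative definiteness follows by expanding squared distances. -/

theorem Real.two_mul_log (x : ℝ) : 2 * Real.log x = Real.log (x ^ 2) := by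
  rw [Real.log_pow, Nat.cast_two]

/-- `1 + χ(z, w) / 2 = |z̄ - w|² / (4 Im z Im w)`. -/
theorem one_add_cauchyChi_div_two (z w : UpperHalfPlane) :
    1 + cauchyChi z w / 2 = ‖conj (z : ℂ) - w‖ ^ 2 / (4 * z.im * w.im) := by
  have hz := z.im_pos
  have hw := w.im_pos
  rw [cauchyChi, Complex.sq_norm, Complex.sq_norm, Complex.normSq_apply, Complex.normSq_apply]
  simp only [Complex.sub_re, Complex.sub_im, Complex.conj_re, Complex.conj_im,
    UpperHalfPlane.coe_re, UpperHalfPlane.coe_im]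
  field_simp
  ring

theorem one_le_one_add_cauchyChi_div_two (z w : UpperHalfPlane) : 1 ≤ 1 + cauchyChi z w / 2 := by
  have hz := z.im_pos
  have hw := w.im_pos
  have : 0 ≤ cauchyChi z w := by unfold cauchyChi; positivity
  linarith

theorem norm_conj_sub_pos (z w : UpperHalfPlane) : 0 < ‖conj (z : ℂ) - w‖ := by
  rw [norm_pos_iff]
  intro h
  have := congrArg Complex.im h
  simp only [Complex.sub_im, Complex.conj_im, UpperHalfPlane.coe_im, Complex.zero_im] at this
  linarith [z.im_pos, w.im_pos]

/-- Places the point `c` of the log density ratio inside the unit disk. -/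
theorem norm_sub_lt_norm_conj_sub (z w : UpperHalfPlane) :
    ‖(z : ℂ) - w‖ < ‖conj (z : ℂ) - w‖ := by
  rw [← sq_lt_sq₀ (norm_nonneg _) (norm_nonneg _), Complex.sq_norm, Complex.sq_norm,
    Complex.normSq_apply, Complex.normSq_apply]
  simp only [Complex.sub_re, Complex.sub_im, Complex.conj_re, Complex.conj_im,
    UpperHalfPlane.coe_re, UpperHalfPlane.coe_im]
  nlinarith [mul_pos z.im_pos w.im_pos]

theorem norm_ofReal_sub_pos (z : UpperHalfPlane) (x : ℝ) : 0 < ‖(x : ℂ) - z‖ := by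
  rw [norm_pos_iff]
  intro h
  have := congrArg Complex.im h
  simp only [Complex.sub_im, Complex.ofReal_im, UpperHalfPlane.coe_im, Complex.zero_im] at this
  linarith [z.im_pos]

/-! ### Density ratios of Cauchy distributions -/

/-- The density of the Cauchy distribution `cauchyDist z`. -/
noncomputable def cauchyDensity (z : UpperHalfPlane) (x : ℝ) : ℝ :=
  z.im / (Real.pi * ‖(x : ℂ) - z‖ ^ 2)

theorem cauchyDensity_pos (z : UpperHalfPlane) (x : ℝ) : 0 < cauchyDensity z x := by
  have := norm_ofReal_sub_pos z x
  have := z.im_pos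
  unfold cauchyDensity
  positivity

theorem measurable_cauchyDensity (z : UpperHalfPlane) : Measurable (cauchyDensity z) := by
  unfold cauchyDensity
  fun_prop

instance (z : UpperHalfPlane) : IsProbabilityMeasure (cauchyDist z) := by
  unfold cauchyDist
  infer_instance

theorem cauchyDist_eq_withDensity_cauchyDensity (z : UpperHalfPlane) :
    cauchyDist z = volume.withDensity (fun x => ENNReal.ofReal (cauchyDensity z x)) :=
  cauchyDist_eq_withDensity z

theorem cauchyDist_eq_withDensity_cauchyDist (z w : UpperHalfPlane) :
    cauchyDist z = (cauchyDist w).withDensity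
      (fun x => ENNReal.ofReal (cauchyDensity z x / cauchyDensity w x)) := by
  have h := withDensity_mul volume (measurable_cauchyDensity w).ennreal_ofReal
    ((measurable_cauchyDensity z).div (measurable_cauchyDensity w)).ennreal_ofReal
  simp only [Pi.div_apply] at h
  rw [cauchyDist_eq_withDensity_cauchyDensity w, ← h, cauchyDist_eq_withDensity_cauchyDensity z]
  congr 1
  funext x
  have := cauchyDensity_pos w x
  rw [Pi.mul_apply, ← ENNReal.ofReal_mul this.le]
  congr 1
  field_simp

theorem cauchyDist_absolutelyContinuous (z w : UpperHalfPlane) :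
    cauchyDist z ≪ cauchyDist w := by
  rw [cauchyDist_eq_withDensity_cauchyDist z w]
  exact withDensity_absolutelyContinuous _ _

theorem llr_cauchyDist (z w : UpperHalfPlane) :
    llr (cauchyDist z) (cauchyDist w) =ᵐ[cauchyDist z]
      fun x => Real.log (cauchyDensity z x / cauchyDensity w x) := by
  apply (cauchyDist_absolutelyContinuous z w).ae_le
  have h := Measure.rnDeriv_withDensity (cauchyDist w)
    ((measurable_cauchyDensity z).div (measurable_cauchyDensity w)).ennreal_ofReal
  simp only [Pi.div_apply] at h
  rw [← cauchyDist_eq_withDensity_cauchyDist z w] at h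
  filter_upwards [h] with x hx
  rw [llr_def]
  simp only [hx]
  rw [ENNReal.toReal_ofReal (div_pos (cauchyDensity_pos z x) (cauchyDensity_pos w x)).le]

/-! ### Transfer to the unit circle -/

/-- The diffeomorphism from the real line to `(-π, π)` carrying the Cauchy distribution with
parameter `z` to the uniform distribution. -/
noncomputable def cauchyAngle (z : UpperHalfPlane) (x : ℝ) : ℝ :=
  2 * Real.arctan ((x - z.re) / z.im)

theorem hasDerivAt_cauchyAngle (z : UpperHalfPlane) (x : ℝ) :
    HasDerivAt (cauchyAngle z) (2 * Real.pi * cauchyDensity z x) x := by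
  have hz := z.im_pos
  have hx := norm_ofReal_sub_pos z x
  have h := ((((hasDerivAt_id x).sub_const z.re).div_const z.im).arctan).const_mul 2
  convert! h using 1
  simp only [id]
  have e : ‖(x : ℂ) - z‖ ^ 2 = (x - z.re) ^ 2 + z.im ^ 2 := by
    rw [Complex.sq_norm, Complex.normSq_apply]
    simp only [Complex.sub_re, Complex.sub_im, Complex.ofReal_re, Complex.ofReal_im,
      UpperHalfPlane.coe_re, UpperHalfPlane.coe_im]
    ring
  have : 0 < (x - z.re) ^ 2 + z.im ^ 2 := by positivity
  rw [cauchyDensity, e]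
  field_simp
  ring

theorem injective_cauchyAngle (z : UpperHalfPlane) : Function.Injective (cauchyAngle z) := by
  intro x y h
  have hz := z.im_pos.ne'
  have h1 := Real.arctan_injective (mul_left_cancel₀ two_ne_zero h)
  field_simp at h1
  linarith

theorem range_cauchyAngle (z : UpperHalfPlane) :
    cauchyAngle z '' Set.univ = Set.Ioo (-Real.pi) Real.pi := by
  ext θ
  simp only [Set.image_univ, Set.mem_range, cauchyAngle, Set.mem_Ioo]
  constructor
  · rintro ⟨x, rfl⟩
    constructor <;> linarith [Real.neg_pi_div_two_lt_arctan ((x - z.re) / z.im),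
      Real.arctan_lt_pi_div_two ((x - z.re) / z.im)]
  · rintro ⟨h1, h2⟩
    refine ⟨z.re + z.im * Real.tan (θ / 2), ?_⟩
    rw [add_sub_cancel_left, mul_div_cancel_left₀ _ z.im_pos.ne',
      Real.arctan_tan (by linarith) (by linarith)]
    ring

theorem abs_deriv_cauchyAngle (z : UpperHalfPlane) (x : ℝ) :
    |2 * Real.pi * cauchyDensity z x| = 2 * Real.pi * cauchyDensity z x :=
  abs_of_pos (mul_pos Real.two_pi_pos (cauchyDensity_pos z x))

theorem integrable_cauchyDist_iff (z : UpperHalfPlane) (f : ℝ → ℝ) :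
    Integrable f (cauchyDist z) ↔ Integrable (fun x => cauchyDensity z x * f x) := by
  rw [cauchyDist_eq_withDensity_cauchyDensity, integrable_withDensity_iff_integrable_smul'
    (measurable_cauchyDensity z).ennreal_ofReal (by simp)]
  simp only [ENNReal.toReal_ofReal (cauchyDensity_pos z _).le, smul_eq_mul]

theorem integral_cauchyDist (z : UpperHalfPlane) (f : ℝ → ℝ) :
    ∫ x, f x ∂(cauchyDist z) = ∫ x, cauchyDensity z x * f x := by
  rw [cauchyDist_eq_withDensity_cauchyDensity, integral_withDensity_eq_integral_toReal_smul
    (measurable_cauchyDensity z).ennreal_ofReal (by simp)]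
  simp only [ENNReal.toReal_ofReal (cauchyDensity_pos z _).le, smul_eq_mul]

/-- Integrability on the unit circle transfers to integrability for a Cauchy distribution. -/
theorem CircleIntegrable.integrable_comp_cauchyAngle {g : ℂ → ℝ} (hg : CircleIntegrable g 0 1)
    (z : UpperHalfPlane) :
    Integrable (fun x => g (circleMap 0 1 (cauchyAngle z x))) (cauchyDist z) := by
  have hp : Function.Periodic (fun θ => g (circleMap 0 1 θ)) (2 * Real.pi) := fun θ => by
    simp only [periodic_circleMap 0 1 θ]
  -- Periodicity moves the period from `(0, 2π)` to `(-π, π)`, the range of `cauchyAngle`.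
  have h1 := hp.intervalIntegrable₀ Real.two_pi_pos.ne' hg (-Real.pi) Real.pi
  rw [intervalIntegrable_iff_integrableOn_Ioo_of_le (by linarith [Real.pi_pos]),
    ← range_cauchyAngle z, integrableOn_image_iff_integrableOn_abs_deriv_smul MeasurableSet.univ
      (fun x _ => (hasDerivAt_cauchyAngle z x).hasDerivWithinAt)
      (injective_cauchyAngle z).injOn, integrableOn_univ] at h1
  rw [integrable_cauchyDist_iff]
  convert! h1.const_mul (2 * Real.pi)⁻¹ using 2 with x
  rw [abs_deriv_cauchyAngle, smul_eq_mul]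
  field_simp

/-- Integrals for a Cauchy distribution are averages over the unit circle. -/
theorem integral_comp_cauchyAngle (g : ℂ → ℝ) (z : UpperHalfPlane) :
    ∫ x, g (circleMap 0 1 (cauchyAngle z x)) ∂(cauchyDist z) = Real.circleAverage g 0 1 := by
  have hp : Function.Periodic (fun θ => g (circleMap 0 1 θ)) (2 * Real.pi) := fun θ => by
    simp only [periodic_circleMap 0 1 θ]
  have h1 := hp.intervalIntegral_add_eq 0 (-Real.pi)
  rw [zero_add, show -Real.pi + 2 * Real.pi = Real.pi by ring,
    intervalIntegral.integral_of_le (by linarith [Real.pi_pos] : -Real.pi ≤ Real.pi),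
    integral_Ioc_eq_integral_Ioo, ← range_cauchyAngle z,
    integral_image_eq_integral_abs_deriv_smul MeasurableSet.univ
      (fun x _ => (hasDerivAt_cauchyAngle z x).hasDerivWithinAt)
      (injective_cauchyAngle z).injOn, Measure.restrict_univ] at h1
  rw [Real.circleAverage_def, h1, smul_eq_mul, integral_cauchyDist, ← integral_const_mul]
  congr 1
  funext x
  rw [abs_deriv_cauchyAngle, smul_eq_mul]
  field_simp

/-- In the coordinate on the unit circle, `cauchyAngle` is a Cayley transform. -/
theorem circleMap_cauchyAngle (z : UpperHalfPlane) (x : ℝ) :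
    circleMap 0 1 (cauchyAngle z x) * (x - conj (z : ℂ)) = -(x - z) := by
  have hz := z.im_pos
  set t := (x - z.re) / z.im with ht
  have hx : x = z.re + z.im * t := by rw [ht]; field_simp; ring
  have h1 : (0 : ℝ) < 1 + t ^ 2 := by positivity
  have hc : Real.cos (2 * Real.arctan t) = (1 - t ^ 2) / (1 + t ^ 2) := by
    rw [Real.cos_two_mul, Real.cos_sq_arctan]; field_simp; ring
  have hs : Real.sin (2 * Real.arctan t) = 2 * t / (1 + t ^ 2) := by
    rw [Real.sin_two_mul, Real.sin_arctan, Real.cos_arctan]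
    have := Real.sq_sqrt h1.le
    field_simp
    rw [this]
  have hm : circleMap 0 1 (cauchyAngle z x)
      = ⟨(1 - t ^ 2) / (1 + t ^ 2), 2 * t / (1 + t ^ 2)⟩ := by
    rw [← hc, ← hs, cauchyAngle, ← ht, circleMap]
    apply Complex.ext
    · simp [Complex.exp_ofReal_mul_I_re, -Complex.ofReal_mul, -Complex.ofReal_ofNat]
    · simp [Complex.exp_ofReal_mul_I_im, -Complex.ofReal_mul, -Complex.ofReal_ofNat]
  rw [hm, hx]
  apply Complex.ext
  · simp only [Complex.mul_re, Complex.sub_re, Complex.sub_im, Complex.conj_re, Complex.conj_im,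
      Complex.ofReal_re, Complex.ofReal_im, UpperHalfPlane.coe_re, UpperHalfPlane.coe_im,
      Complex.neg_re]
    field_simp
    ring
  · simp only [Complex.mul_im, Complex.sub_re, Complex.sub_im, Complex.conj_re, Complex.conj_im,
      Complex.ofReal_re, Complex.ofReal_im, UpperHalfPlane.coe_re, UpperHalfPlane.coe_im,
      Complex.neg_im]
    field_simp
    ring

/-! ### The divergence formula -/

theorem log_cauchyDensity_div (z w : UpperHalfPlane) (x : ℝ)
    (hu : circleMap 0 1 (cauchyAngle z x) ≠ -((z : ℂ) - w) / (conj (z : ℂ) - w)) :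
    Real.log (cauchyDensity z x / cauchyDensity w x) =
      Real.log (1 + cauchyChi z w / 2) +
        2 * Real.log ‖circleMap 0 1 (cauchyAngle z x) - -((z : ℂ) - w) / (conj (z : ℂ) - w)‖ := by
  have hz := z.im_pos
  have hw := w.im_pos
  have hK := norm_conj_sub_pos z w
  have hxz := norm_ofReal_sub_pos z x
  have hxw := norm_ofReal_sub_pos w x
  have hK' : conj (z : ℂ) - w ≠ 0 := norm_pos_iff.1 hK
  have hu0 := norm_pos_iff.2 (sub_ne_zero.2 hu)
  set u := circleMap 0 1 (cauchyAngle z x) with hu_def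
  -- The subtracted constant is the value of `-(x - z) / (x - z̄)` at `x = w`, hence the factor `x -
  -- w`.
  have key : (u - -((z : ℂ) - w) / (conj (z : ℂ) - w)) * (x - conj (z : ℂ)) * (conj (z : ℂ) - w)
      = (z - conj (z : ℂ)) * (x - w) := by
    have h := circleMap_cauchyAngle z x
    rw [← hu_def] at h
    rw [sub_mul, h]
    field_simp
    ring
  have hn := congrArg norm key
  rw [norm_mul, norm_mul, norm_mul] at hn
  have e1 : ‖(x : ℂ) - conj (z : ℂ)‖ = ‖(x : ℂ) - z‖ := by
    rw [← Complex.norm_conj]; simp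
  have e2 : ‖(z : ℂ) - conj (z : ℂ)‖ = 2 * z.im := by
    rw [Complex.sub_conj]
    simp [abs_of_pos hz]
  rw [e1, e2] at hn
  rw [one_add_cauchyChi_div_two, Real.two_mul_log, ← Real.log_mul (by positivity)
    (by positivity)]
  congr 1
  unfold cauchyDensity
  have hxw' : ‖(x : ℂ) - w‖ = ‖u - -((z : ℂ) - w) / (conj (z : ℂ) - w)‖ * ‖(x : ℂ) - z‖ *
      ‖conj (z : ℂ) - w‖ / (2 * z.im) := by
    rw [hn]; field_simp
  rw [hxw']
  field_simp
  ring

theorem cauchyKL_ne_top_and_toReal (z w : UpperHalfPlane) :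
    cauchyKL z w ≠ ∞ ∧ (cauchyKL z w).toReal = Real.log (1 + cauchyChi z w / 2) := by
  set c : ℂ := -((z : ℂ) - w) / (conj (z : ℂ) - w) with hc
  have hc1 : ‖c‖ < 1 := by
    rw [hc, norm_div, norm_neg, div_lt_one (norm_conj_sub_pos z w)]
    exact norm_sub_lt_norm_conj_sub z w
  have hac := cauchyDist_absolutelyContinuous z w
  have hne : ∀ x, circleMap 0 1 (cauchyAngle z x) ≠ c := fun x h => by
    rw [← h, norm_circleMap_zero] at hc1
    simp at hc1
  have hllr := llr_cauchyDist z w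
  simp only [fun x => log_cauchyDensity_div z w x (hne x)] at hllr
  rw [← hc] at hllr
  have hi := (circleIntegrable_log_norm_sub_const (a := c) (c := 0) 1).integrable_comp_cauchyAngle z
  have hint : Integrable (llr (cauchyDist z) (cauchyDist w)) (cauchyDist z) :=
    ((integrable_const _).add (hi.const_mul 2)).congr hllr.symm
  refine ⟨InformationTheory.klDiv_ne_top hac hint, ?_⟩
  -- Equal total masses reduce `klDiv` to the integral of `llr`.
  rw [cauchyKL, InformationTheory.toReal_klDiv_of_measure_eq hac (by simp),
    integral_congr_ae hllr, integral_add (integrable_const _) (hi.const_mul 2),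
    integral_const_mul, integral_comp_cauchyAngle (fun u => Real.log ‖u - c‖) z,
    circleAverage_log_norm_sub_const₀ hc1]
  simp
-- Hilbert embedding through the unit disk
/-- The Cayley transform from the upper half-plane to the unit disk. -/
noncomputable def cayley (z : UpperHalfPlane) : ℂ := (z - Complex.I) / (z + Complex.I)

theorem coe_add_I_ne_zero (z : UpperHalfPlane) : (z : ℂ) + Complex.I ≠ 0 := fun h => by
  have := congrArg Complex.im h
  simp only [Complex.add_im, Complex.I_im, UpperHalfPlane.coe_im, Complex.zero_im] at this
  linarith [z.im_pos]

theorem norm_cayley_lt_one (z : UpperHalfPlane) : ‖cayley z‖ < 1 := by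
  rw [cayley, norm_div, div_lt_one (norm_pos_iff.2 (coe_add_I_ne_zero z)),
    ← sq_lt_sq₀ (norm_nonneg _) (norm_nonneg _), Complex.sq_norm, Complex.sq_norm,
    Complex.normSq_apply, Complex.normSq_apply]
  simp only [Complex.sub_re, Complex.sub_im, Complex.add_re, Complex.add_im, Complex.I_re,
    Complex.I_im, UpperHalfPlane.coe_re, UpperHalfPlane.coe_im]
  nlinarith [z.im_pos]

theorem one_sub_cayley_mul_conj (z w : UpperHalfPlane) :
    1 - cayley z * conj (cayley w) =
      2 * Complex.I * (conj (w : ℂ) - z) / ((z + Complex.I) * conj (w + Complex.I)) := by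
  have hz := coe_add_I_ne_zero z
  have hw := (map_ne_zero (starRingEnd ℂ)).2 (coe_add_I_ne_zero w)
  simp only [cayley, map_div₀]
  rw [eq_div_iff (mul_ne_zero hz hw)]
  field_simp
  simp only [map_add, map_sub, Complex.conj_I]
  ring_nf

/-- The polarised shape `k(z,z) + k(w,w) - 2 k(z,w)` of a squared distance, with `k = -log |1 - u
v̄|`. -/
theorem log_one_add_cauchyChi_eq (z w : UpperHalfPlane) :
    Real.log (1 + cauchyChi z w / 2) =
      2 * Real.log ‖1 - cayley z * conj (cayley w)‖ - Real.log ‖1 - cayley z * conj (cayley z)‖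
        - Real.log ‖1 - cayley w * conj (cayley w)‖ := by
  have hz := z.im_pos
  have hw := w.im_pos
  have hz' := norm_pos_iff.2 (coe_add_I_ne_zero z)
  have hw' := norm_pos_iff.2 (coe_add_I_ne_zero w)
  have hK := norm_conj_sub_pos w z
  have hK2 : ‖conj (z : ℂ) - w‖ = ‖conj (w : ℂ) - z‖ := by
    rw [← Complex.norm_conj, map_sub, Complex.conj_conj, norm_sub_rev]
  have e (z : UpperHalfPlane) : ‖conj (z : ℂ) - z‖ = 2 * z.im := by
    rw [norm_sub_rev, Complex.sub_conj]
    simp [abs_of_pos z.im_pos]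
  rw [one_add_cauchyChi_div_two, hK2]
  simp only [one_sub_cayley_mul_conj, norm_div, norm_mul, Complex.norm_conj, e, Complex.norm_I,
    Complex.norm_ofNat]
  rw [Real.two_mul_log, ← Real.log_div (by positivity) (by positivity),
    ← Real.log_div (by positivity) (by positivity)]
  congr 1
  field_simp
  ring

theorem hasSum_re_pow_div_neg_log {u : ℂ} (hu : ‖u‖ < 1) :
    HasSum (fun n : ℕ => (u ^ (n + 1)).re / (n + 1)) (-Real.log ‖1 - u‖) := by
  -- The dropped term of index `0` is `u ^ 0 / 0 = 0`.
  have h := Complex.hasSum_re ((hasSum_nat_add_iff' 1).2 (Complex.hasSum_taylorSeries_neg_log hu))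
  convert! h using 1
  · funext n
    rw [← Nat.cast_succ, ← Complex.ofReal_natCast, Complex.div_ofReal_re]
  · simp [Complex.log_re]

theorem norm_mul_conj_lt_one {u v : ℂ} (hu : ‖u‖ < 1) (hv : ‖v‖ < 1) : ‖u * conj v‖ < 1 := by
  rw [norm_mul, Complex.norm_conj]
  nlinarith [norm_nonneg u, norm_nonneg v]

theorem memℓp_pow_div_sqrt {u : ℂ} (hu : ‖u‖ < 1) :
    Memℓp (fun n : ℕ => u ^ (n + 1) / (Real.sqrt (n + 1) : ℂ)) 2 := by
  apply memℓp_gen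
  -- The squared norms are the terms of the logarithm series at `u ū`.
  refine (hasSum_re_pow_div_neg_log (norm_mul_conj_lt_one hu hu)).summable.congr fun n => ?_
  have : (0 : ℝ) < n + 1 := by positivity
  rw [ENNReal.toReal_ofNat, Real.rpow_ofNat, norm_div, div_pow, Complex.norm_real,
    Real.norm_of_nonneg (Real.sqrt_nonneg _), Real.sq_sqrt this.le, Complex.mul_conj,
    ← Complex.ofReal_pow, Complex.ofReal_re, Complex.normSq_eq_norm_sq, norm_pow]
  ring

/-- The point `(uⁿ / √n)ₙ≥₁` of `ℓ²` attached to `u` in the unit disk; its Gram kernel is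
`-log (1 - u v̄)`. -/
noncomputable def logFeature (u : ℂ) (hu : ‖u‖ < 1) : lp (fun _ : ℕ => ℂ) 2 :=
  ⟨fun n => u ^ (n + 1) / (Real.sqrt (n + 1) : ℂ), memℓp_pow_div_sqrt hu⟩

theorem norm_logFeature_sub_sq {u v : ℂ} (hu : ‖u‖ < 1) (hv : ‖v‖ < 1) :
    ‖logFeature u hu - logFeature v hv‖ ^ 2 =
      2 * Real.log ‖1 - u * conj v‖ - Real.log ‖1 - u * conj u‖ - Real.log ‖1 - v * conj v‖ := by
  have h1 := hasSum_re_pow_div_neg_log (norm_mul_conj_lt_one hu hu)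
  have h2 := hasSum_re_pow_div_neg_log (norm_mul_conj_lt_one hv hv)
  have h3 := hasSum_re_pow_div_neg_log (norm_mul_conj_lt_one hu hv)
  have hs := (h1.add h2).sub (h3.mul_left 2)
  have hn := lp.norm_rpow_eq_tsum (p := 2) (by simp) (logFeature u hu - logFeature v hv)
  rw [ENNReal.toReal_ofNat, Real.rpow_ofNat] at hn
  rw [hn, show 2 * Real.log ‖1 - u * conj v‖ - Real.log ‖1 - u * conj u‖
    - Real.log ‖1 - v * conj v‖ = -Real.log ‖1 - u * conj u‖ + -Real.log ‖1 - v * conj v‖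
      - 2 * -Real.log ‖1 - u * conj v‖ by ring, ← hs.tsum_eq]
  refine tsum_congr fun n => ?_
  have : (0 : ℝ) < n + 1 := by positivity
  rw [Real.rpow_ofNat]
  change ‖u ^ (n + 1) / (Real.sqrt (n + 1) : ℂ) - v ^ (n + 1) / (Real.sqrt (n + 1) : ℂ)‖ ^ 2 = _
  rw [← sub_div, norm_div, div_pow, Complex.norm_real,
    Real.norm_of_nonneg (Real.sqrt_nonneg _), Real.sq_sqrt this.le, Complex.sq_norm, Complex.normSq_sub]
  simp only [← mul_pow, Complex.mul_conj, ← Complex.ofReal_pow, Complex.ofReal_re, map_pow]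
  ring

theorem isHilbertEmbeddable_sqrt_log_cauchyChi :
    IsHilbertEmbeddable
      (fun z w : UpperHalfPlane => Real.sqrt (Real.log (1 + cauchyChi z w / 2))) := by
  refine ⟨lp (fun _ : ℕ => ℂ) 2, inferInstance, InnerProductSpace.complexToReal, inferInstance,
    fun z => logFeature (cayley z) (norm_cayley_lt_one z), fun z w => ?_⟩
  beta_reduce
  rw [log_one_add_cauchyChi_eq, ← norm_logFeature_sub_sq (norm_cayley_lt_one z)
    (norm_cayley_lt_one w), Real.sqrt_sq (norm_nonneg _)]

/-- Schoenberg: squares of Hilbert space distances are conditionally negative definite. -/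
theorem IsHilbertEmbeddable.isCondNegDef_sq {X : Type} {d : X → X → ℝ}
    (h : IsHilbertEmbeddable d) : IsCondNegDef (fun x y => d x y ^ 2) := by
  obtain ⟨H, _, _, _, φ, hφ⟩ := h
  refine ⟨fun x y => by simp only [← hφ, norm_sub_rev], fun n x c hc => ?_⟩
  have e : ∑ i, ∑ j, c i * c j * d (x i) (x j) ^ 2 = -2 * ‖∑ i, c i • φ (x i)‖ ^ 2 := by
    have h1 (i j : Fin n) : c i * c j * d (x i) (x j) ^ 2 =
        c i * ‖φ (x i)‖ ^ 2 * c j + c i * (c j * ‖φ (x j)‖ ^ 2)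
          - 2 * inner ℝ (c i • φ (x i)) (c j • φ (x j)) := by
      rw [← hφ, norm_sub_sq_real, real_inner_smul_left, real_inner_smul_right]
      ring
    -- `∑ c i = 0` kills both `‖φ‖²` terms, leaving only the inner products.
    simp only [h1, Finset.sum_sub_distrib, Finset.sum_add_distrib, ← Finset.mul_sum, hc,
      ← Finset.sum_mul, zero_mul, mul_zero, Finset.sum_const_zero]
    rw [← real_inner_self_eq_norm_sq, sum_inner]
    simp only [inner_sum]
    ring
  rw [e]
  nlinarith [sq_nonneg ‖∑ i, c i • φ (x i)‖]

theorem mainTheorem5 :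
    (∀ z w : UpperHalfPlane,
      cauchyKL z w ≠ ∞ ∧ (cauchyKL z w).toReal = Real.log (1 + cauchyChi z w / 2)) ∧
    IsHilbertEmbeddable (fun z w : UpperHalfPlane => Real.sqrt (cauchyKL z w).toReal) ∧
    IsCondNegDef (fun z w : UpperHalfPlane => Real.log (1 + cauchyChi z w / 2)) := by
  refine ⟨cauchyKL_ne_top_and_toReal, ?_, ?_⟩
  · simp only [fun z w => (cauchyKL_ne_top_and_toReal z w).2]
    exact isHilbertEmbeddable_sqrt_log_cauchyChi
  · have h := isHilbertEmbeddable_sqrt_log_cauchyChi.isCondNegDef_sq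
    simpa only [Real.sq_sqrt (Real.log_nonneg (one_le_one_add_cauchyChi_div_two _ _))] using h
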